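/- Let $G=(V,E,w)$ be a finite connected simple undirected graph with $n=|V|\ge 1$ vertices, $m=|E|$ edges and positive edge weights $w:E\to(0,\infty)$. For a spanning tree $T$ of $G$ and an edge $e\in E$, let $p_T(e)$ be the set of edges on the unique path in $T$ between the endpoints of $e$, and define the stretch $$\mathrm{St}_T(e)=\sum_{e'\in p_T(e)}\frac{w(e)}{w(e')},\qquad \mathrm{St}_T(G)=\sum_{e\in E}\mathrm{St}_T(e).$$ Let $\mathcal T$ be a random spanning tree of $G$, where each spanning tree $T$ is chosen with probability proportional to $\prod_{e\in T}w(e)$. Then $$\mathbb E\left[\mathrm{St}_{\mathcal T}(G)\right]\le (n-1)(m-n+2),$$ and if not every set of $n-1$ edges of $G$ is the edge set of a spanning tree (equivalently, if $G$ is neither a tree nor a cycle), then the inequality is strict: $$\mathbb E\left[\mathrm{St}_{\mathcal T}(G)\right]<(n-1)(m-n+2).$$ -/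

import Mathlib

/-- The graph `(V, F)` is a spanning tree of `G`: `F` is a set of edges of `G` and the graph on the
whole vertex set `V` with edge set `F` is a tree. -/
def IsSpanningTree {V : Type*} [Fintype V] [DecidableEq V] (G : SimpleGraph V)
    [DecidableRel G.Adj] (F : Finset (Sym2 V)) : Prop :=
  F ⊆ G.edgeFinset ∧ (SimpleGraph.fromEdgeSet (F : Set (Sym2 V))).IsTree

open Classical in
/-- The finite set of all spanning trees of `G`, each given by its edge set. -/
noncomputable def spanningTrees {V : Type*} [Fintype V] [DecidableEq V] (G : SimpleGraph V)
    [DecidableRel G.Adj] : Finset (Finset (Sym2 V)) :=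
  G.edgeFinset.powerset.filter (fun F => IsSpanningTree G F)

open Classical in
/-- The edges on the paths in `(V, F)` between the two endpoints of `e`. If `(V, F)` is a tree,
there is exactly one such path (up to its direction). -/
noncomputable def treePathEdges {V : Type*} (F : Finset (Sym2 V)) (e : Sym2 V) :
    Finset (Sym2 V) :=
  F.filter (fun e' => ∃ (u v : V) (p : (SimpleGraph.fromEdgeSet (F : Set (Sym2 V))).Walk u v),
    s(u, v) = e ∧ p.IsPath ∧ e' ∈ p.edges)

/-- The stretch of the edge `e` with respect to the tree with edge set `F`. -/
noncomputable def edgeStretch {V : Type*} (w : Sym2 V → ℝ) (F : Finset (Sym2 V)) (e : Sym2 V) :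
    ℝ :=
  ∑ e' ∈ treePathEdges F e, w e / w e'

/-- The stretch of the graph `G` with respect to the tree with edge set `F`. -/
noncomputable def graphStretch {V : Type*} [Fintype V] [DecidableEq V] (G : SimpleGraph V)
    [DecidableRel G.Adj] (w : Sym2 V → ℝ) (F : Finset (Sym2 V)) : ℝ :=
  ∑ e ∈ G.edgeFinset, edgeStretch w F e

/-- The probability of the spanning tree `F` when spanning trees of `G` are sampled with
probability proportional to the product of the edge weights. -/
noncomputable def treeProb {V : Type*} [Fintype V] [DecidableEq V] (G : SimpleGraph V)
    [DecidableRel G.Adj] (w : Sym2 V → ℝ) (F : Finset (Sym2 V)) : ℝ :=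
  (∏ e ∈ F, w e) / ∑ F' ∈ spanningTrees G, ∏ e ∈ F', w e

/-- The expected stretch of `G` with respect to a random spanning tree distributed according to
`treeProb`. -/
noncomputable def expectedStretch {V : Type*} [Fintype V] [DecidableEq V] (G : SimpleGraph V)
    [DecidableRel G.Adj] (w : Sym2 V → ℝ) : ℝ :=
  ∑ F ∈ spanningTrees G, treeProb G w F * graphStretch G w F

/-! Let `Z` be the total weight of all spanning trees. The edges of a tree `F` contribute at most `n
- 1` to its stretch. If `e ∉ F` and `e'` lies on the tree path of `e`, then `w(F) * w e / w e'` is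
the weight of the spanning tree `F - e' + e`. The map `(F, e, e') ↦ (F - e' + e, e, e')` is
injective into triples (tree, edge inside, edge outside), whose total weight is `Z * (n - 1) * (m -
n + 1)`. Adding both parts and dividing by `Z` gives the bound. If it were attained, the map would
be onto, so spanning trees would be closed under every exchange and every set of `n - 1` edges would
be one. -/

theorem mem_treePathEdges {V : Type*} {F : Finset (Sym2 V)} {e e' : Sym2 V} :
    e' ∈ treePathEdges F e ↔ e' ∈ F ∧
      ∃ (u v : V) (p : (SimpleGraph.fromEdgeSet (F : Set (Sym2 V))).Walk u v),
        s(u, v) = e ∧ p.IsPath ∧ e' ∈ p.edges := by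
  classical
  exact Finset.mem_filter

theorem mem_of_mem_treePathEdges {V : Type*} {F : Finset (Sym2 V)} {e e' : Sym2 V}
    (h : e' ∈ treePathEdges F e) : e' ∈ F :=
  (mem_treePathEdges.1 h).1

/-- In a tree, the path between the endpoints of a tree edge is that edge. -/
theorem treePathEdges_subset_singleton {V : Type*} {F : Finset (Sym2 V)}
    (hF : (SimpleGraph.fromEdgeSet (F : Set (Sym2 V))).IsTree) {e : Sym2 V} (he : e ∈ F)
    (hd : ¬ e.IsDiag) : treePathEdges F e ⊆ {e} := by
  intro e' he'
  obtain ⟨-, u, v, p, rfl, hp, hep⟩ := mem_treePathEdges.1 he'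
  have hadj : (SimpleGraph.fromEdgeSet (F : Set (Sym2 V))).Adj u v := by
    rw [SimpleGraph.fromEdgeSet_adj]
    exact ⟨by exact_mod_cast he, by simpa using hd⟩
  have h := (hF.isAcyclic.subsingleton_path u v).elim ⟨p, hp⟩ (SimpleGraph.Path.singleton hadj)
  have h' : p = hadj.toWalk := congrArg Subtype.val h
  rw [h'] at hep
  simpa using hep

/-- Exchanging an edge on the tree path between the endpoints of `e` for `e` gives a tree. -/
theorem isTree_insert_erase {V : Type*} [Fintype V] [DecidableEq V] {F : Finset (Sym2 V)}
    (hF : (SimpleGraph.fromEdgeSet (F : Set (Sym2 V))).IsTree) (hFd : ∀ f ∈ F, ¬ f.IsDiag)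
    {e e' : Sym2 V} (he : e ∉ F) (hd : ¬ e.IsDiag) (he' : e' ∈ treePathEdges F e) :
    (SimpleGraph.fromEdgeSet ((insert e (F.erase e') : Finset (Sym2 V)) : Set (Sym2 V))).IsTree := by
  obtain ⟨hF', u, v, p, rfl, hp, hep⟩ := mem_treePathEdges.1 he'
  have hne : e' ≠ s(u, v) := fun h => he (h ▸ hF')
  set H := SimpleGraph.fromEdgeSet ((insert s(u, v) F : Finset (Sym2 V)) : Set (Sym2 V)) with hH
  have hle : SimpleGraph.fromEdgeSet (F : Set (Sym2 V)) ≤ H :=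
    SimpleGraph.fromEdgeSet_mono (by exact_mod_cast Finset.subset_insert _ _)
  have hadj : H.Adj v u := by
    rw [hH, SimpleGraph.fromEdgeSet_adj]
    refine ⟨by simp [Sym2.eq_swap], fun h => hd (by simp [h])⟩
  -- The new edge closes the tree path to a cycle through `e'`, so `e'` is not a bridge and can be
  -- deleted without disconnecting.
  have hcyc : (SimpleGraph.Walk.cons hadj (p.mapLe hle)).IsCycle := by
    rw [SimpleGraph.Walk.cons_isCycle_iff]
    refine ⟨(SimpleGraph.Walk.isPath_mapLe hle).2 hp, fun h => he ?_⟩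
    rw [SimpleGraph.Walk.edges_mapLe_eq_edges] at h
    have := p.edges_subset_edgeSet h
    rw [SimpleGraph.edgeSet_fromEdgeSet] at this
    rw [Sym2.eq_swap]
    exact_mod_cast this.1
  have hconn : (H.deleteEdges {e'}).Connected := by
    have hnb : ¬ H.IsBridge e' := fun hb => hb.notMem_edges_of_isCycle hcyc (by simp [hep])
    induction e' with
    | _ x y => exact (hF.1.mono hle).connected_delete_edge_of_not_isBridge hnb
  have hEq : H.deleteEdges {e'} =
      SimpleGraph.fromEdgeSet ((insert s(u, v) (F.erase e') : Finset (Sym2 V)) : Set (Sym2 V)) := by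
    ext x y
    simp only [hH, SimpleGraph.deleteEdges_adj, SimpleGraph.fromEdgeSet_adj, Finset.coe_insert,
      Finset.coe_erase, Set.mem_insert_iff, Set.mem_sdiff, Set.mem_singleton_iff]
    have : s(x, y) = s(u, v) → s(x, y) ≠ e' := fun h h' => hne (h' ▸ h)
    tauto
  rw [hEq] at hconn
  have hcard : ∀ S : Finset (Sym2 V), (∀ f ∈ S, ¬ f.IsDiag) →
      (SimpleGraph.fromEdgeSet (S : Set (Sym2 V))).edgeSet = S := by
    intro S hS
    rw [SimpleGraph.edgeSet_fromEdgeSet]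
    ext f
    simpa using hS f
  -- Acyclicity follows from connectedness and the unchanged number of edges.
  rw [SimpleGraph.isTree_iff_connected_and_card] at hF ⊢
  refine ⟨hconn, ?_⟩
  rw [← hF.2, hcard F hFd, hcard]
  · simp only [Nat.card_eq_fintype_card, Fintype.card_coe, Finset.coe_sort_coe]
    rw [Finset.card_insert_of_notMem (by simp [he]), Finset.card_erase_add_one hF']
  · intro f hf
    rcases Finset.mem_insert.1 hf with rfl | hf
    · exact hd
    · exact hFd f (Finset.mem_of_mem_erase hf)

theorem mem_spanningTrees {V : Type*} [Fintype V] [DecidableEq V] {G : SimpleGraph V}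
    [DecidableRel G.Adj] {F : Finset (Sym2 V)} :
    F ∈ spanningTrees G ↔ IsSpanningTree G F := by
  simp only [spanningTrees, Finset.mem_filter, Finset.mem_powerset, and_iff_right_iff_imp]
  exact fun h => h.1

theorem not_isDiag_of_mem_edgeFinset {V : Type*} [Fintype V] [DecidableEq V] {G : SimpleGraph V}
    [DecidableRel G.Adj] {e : Sym2 V} (he : e ∈ G.edgeFinset) : ¬ e.IsDiag :=
  G.not_isDiag_of_mem_edgeSet (SimpleGraph.mem_edgeFinset.1 he)

theorem IsSpanningTree.card_add_one {V : Type*} [Fintype V] [DecidableEq V] {G : SimpleGraph V}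
    [DecidableRel G.Adj] {F : Finset (Sym2 V)} (hF : IsSpanningTree G F) :
    F.card + 1 = Fintype.card V := by
  have h := (SimpleGraph.isTree_iff_connected_and_card.1 hF.2).2
  have hS : (SimpleGraph.fromEdgeSet (F : Set (Sym2 V))).edgeSet = F := by
    rw [SimpleGraph.edgeSet_fromEdgeSet]
    ext f
    simpa using fun hf => not_isDiag_of_mem_edgeFinset (hF.1 hf)
  rw [hS] at h
  simpa using h

theorem IsSpanningTree.exchange {V : Type*} [Fintype V] [DecidableEq V] {G : SimpleGraph V}
    [DecidableRel G.Adj] {F : Finset (Sym2 V)} (hF : IsSpanningTree G F) {e e' : Sym2 V}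
    (heG : e ∈ G.edgeFinset) (he : e ∉ F) (he' : e' ∈ treePathEdges F e) :
    IsSpanningTree G (insert e (F.erase e')) :=
  ⟨Finset.insert_subset heG ((Finset.erase_subset _ _).trans hF.1),
    isTree_insert_erase hF.2 (fun _ hf => not_isDiag_of_mem_edgeFinset (hF.1 hf)) he
      (not_isDiag_of_mem_edgeFinset heG) he'⟩

theorem spanningTrees_nonempty {V : Type*} [Fintype V] [DecidableEq V] {G : SimpleGraph V}
    [DecidableRel G.Adj] (hG : G.Connected) : (spanningTrees G).Nonempty := by
  classical
  obtain ⟨T, hTG, hT⟩ := hG.exists_isTree_le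
  refine ⟨T.edgeFinset, mem_spanningTrees.2 ⟨SimpleGraph.edgeFinset_mono hTG, ?_⟩⟩
  rwa [SimpleGraph.coe_edgeFinset, SimpleGraph.fromEdgeSet_edgeSet]

/-- If a family of finsets is closed under exchanging an element for one of `E`, then with a member
it contains all subsets of `E` of the same cardinality. -/
theorem Finset.mem_of_forall_exchange {α : Type*} [DecidableEq α] {E : Finset α}
    {P : Finset α → Prop}
    (hP : ∀ T, P T → ∀ e ∈ T, ∀ e' ∈ E \ T, P (insert e' (T.erase e)))
    {H : Finset α} (hH : H ⊆ E) :
    ∀ T, P T → T.card = H.card → P H := by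
  intro T hT hcard
  induction hk : (H \ T).card generalizing T with
  | zero =>
    have hsub : H ⊆ T := Finset.sdiff_eq_empty_iff_subset.1 (Finset.card_eq_zero.1 hk)
    rwa [Finset.eq_of_subset_of_card_le hsub hcard.le]
  | succ k ih =>
    obtain ⟨e', he'⟩ := Finset.card_pos.1 (by omega : 0 < (H \ T).card)
    have hTH : (T \ H).card = (H \ T).card := Finset.card_sdiff_comm hcard
    obtain ⟨e, he⟩ := Finset.card_pos.1 (by omega : 0 < (T \ H).card)
    rw [Finset.mem_sdiff] at he he'
    -- Trading `e ∈ T \ H` for `e' ∈ H \ T` moves `T` one step closer to `H`.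
    refine ih (insert e' (T.erase e)) (hP T hT e he.1 e' (by simp [hH he'.1, he'.2])) ?_ ?_
    · rw [Finset.card_insert_of_notMem (by simp [he'.2]), Finset.card_erase_add_one he.1, hcard]
    · have : H \ insert e' (T.erase e) = (H \ T).erase e' := by
        ext x
        have : x ∈ H → x ≠ e := fun h h' => he.2 (h' ▸ h)
        simp only [Finset.mem_sdiff, Finset.mem_insert, Finset.mem_erase]
        tauto
      rw [this, Finset.card_erase_of_mem (by simp [he'.1, he'.2]), hk]
      rfl

/-! ### The exchange map on triples -/

/-- The triples of a spanning tree `F`, an edge `e` outside of it, and an edge on the path in `F`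
between the endpoints of `e`. -/
noncomputable def pathTriples {V : Type*} [Fintype V] [DecidableEq V] (G : SimpleGraph V)
    [DecidableRel G.Adj] : Finset (Finset (Sym2 V) × Sym2 V × Sym2 V) :=
  open Classical in
  (spanningTrees G ×ˢ G.edgeFinset ×ˢ G.edgeFinset).filter
    fun x => x.2.1 ∉ x.1 ∧ x.2.2 ∈ treePathEdges x.1 x.2.1

/-- The triples of a spanning tree, an edge in it, and an edge of `G` outside of it. -/
noncomputable def crossTriples {V : Type*} [Fintype V] [DecidableEq V] (G : SimpleGraph V)
    [DecidableRel G.Adj] : Finset (Finset (Sym2 V) × Sym2 V × Sym2 V) :=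
  (spanningTrees G ×ˢ G.edgeFinset ×ˢ G.edgeFinset).filter
    fun x => x.2.1 ∈ x.1 ∧ x.2.2 ∉ x.1

/-- Exchange the second edge of the triple for the first one. -/
def exchangeTriple {α : Type*} [DecidableEq α] (x : Finset α × α × α) : Finset α × α × α :=
  (insert x.2.1 (x.1.erase x.2.2), x.2.1, x.2.2)

theorem insert_erase_exchange {α : Type*} [DecidableEq α] {F : Finset α} {e e' : α} (he : e ∉ F)
    (he' : e' ∈ F) : insert e' ((insert e (F.erase e')).erase e) = F := by
  rw [Finset.erase_insert (by simp [he]), Finset.insert_erase he']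

section

variable {V : Type*} [Fintype V] [DecidableEq V] {G : SimpleGraph V} [DecidableRel G.Adj]
  {w : Sym2 V → ℝ}

/-- The image still records both edges, so the reverse exchange recovers the tree. -/
theorem injOn_exchangeTriple : Set.InjOn exchangeTriple (SetLike.coe (pathTriples G)) := by
  rintro ⟨F, e, e'⟩ h ⟨F₁, e₁, e₁'⟩ h₁ heq
  simp only [pathTriples, Finset.coe_filter, Set.mem_ofPred_eq] at h h₁
  simp only [exchangeTriple, Prod.mk.injEq] at heq
  obtain ⟨hF, rfl, rfl⟩ := heq
  rw [← insert_erase_exchange h.2.1 (mem_of_mem_treePathEdges h.2.2), hF,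
    insert_erase_exchange h₁.2.1 (mem_of_mem_treePathEdges h₁.2.2)]

theorem image_exchangeTriple_subset : (pathTriples G).image exchangeTriple ⊆ crossTriples G := by
  rintro _ hx
  obtain ⟨⟨F, e, e'⟩, h, rfl⟩ := Finset.mem_image.1 hx
  simp only [pathTriples, Finset.mem_filter, Finset.mem_product, mem_spanningTrees] at h
  obtain ⟨⟨hF, he, he'⟩, heF, hp⟩ := h
  have hne : e' ≠ e := fun h => heF (h ▸ mem_of_mem_treePathEdges hp)
  simp only [crossTriples, exchangeTriple, Finset.mem_filter, Finset.mem_product, mem_spanningTrees]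
  exact ⟨⟨hF.exchange he heF hp, he, he'⟩, by simp, by simp [hne]⟩

theorem prod_pos_of_isSpanningTree (hw : ∀ e ∈ G.edgeSet, 0 < w e) {F : Finset (Sym2 V)}
    (hF : IsSpanningTree G F) : 0 < ∏ e ∈ F, w e :=
  Finset.prod_pos fun e he => hw e (SimpleGraph.mem_edgeFinset.1 (hF.1 he))

theorem sum_crossTriples :
    ∑ x ∈ crossTriples G, ∏ f ∈ x.1, w f =
      (∑ F ∈ spanningTrees G, ∏ f ∈ F, w f) *
        (((Fintype.card V : ℝ) - 1) * ((G.edgeFinset.card : ℝ) - (Fintype.card V : ℝ) + 1)) := by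
  rw [crossTriples, Finset.sum_filter, Finset.sum_product, Finset.sum_mul]
  refine Finset.sum_congr rfl fun F hF => ?_
  rw [mem_spanningTrees] at hF
  have hc : (F.card : ℝ) + 1 = Fintype.card V := by exact_mod_cast hF.card_add_one
  rw [← Finset.sum_filter, Finset.filter_product (fun e => e ∈ F) (fun e => e ∉ F),
    Finset.sum_const (∏ f ∈ F, w f), Finset.card_product, Finset.filter_mem_eq_inter,
    Finset.inter_eq_right.2 hF.1, Finset.filter_notMem_eq_sdiff, nsmul_eq_mul, Nat.cast_mul,
    Finset.cast_card_sdiff hF.1, ← hc]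
  ring

/-- The factor `w e / w e'` turns the weight of `F` into that of the exchanged tree; injectivity
makes this a sum over the image. -/
theorem sum_exchangeTriple (hw : ∀ e ∈ G.edgeSet, 0 < w e) :
    ∑ F ∈ spanningTrees G, (∏ f ∈ F, w f) * ∑ e ∈ G.edgeFinset \ F, edgeStretch w F e =
      ∑ x ∈ (pathTriples G).image exchangeTriple, ∏ f ∈ x.1, w f := by
  classical
  rw [Finset.sum_image injOn_exchangeTriple, pathTriples, Finset.sum_filter, Finset.sum_product]
  refine Finset.sum_congr rfl fun F hF => ?_
  rw [mem_spanningTrees] at hF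
  rw [Finset.sum_product, ← Finset.filter_notMem_eq_sdiff, Finset.sum_filter, Finset.mul_sum]
  refine Finset.sum_congr rfl fun e he => ?_
  by_cases heF : e ∈ F
  · simp [heF]
  have hsub : G.edgeFinset.filter (fun e' => e' ∈ treePathEdges F e) = treePathEdges F e := by
    rw [Finset.filter_mem_eq_inter, Finset.inter_eq_right]
    exact fun e' h => hF.1 (mem_of_mem_treePathEdges h)
  simp only [heF, not_false_eq_true, if_true, true_and]
  rw [← Finset.sum_filter, hsub, edgeStretch, Finset.mul_sum]
  refine Finset.sum_congr rfl fun e' he' => ?_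
  have heF' := mem_of_mem_treePathEdges he'
  have h0 : w e' ≠ 0 := (hw e' (SimpleGraph.mem_edgeFinset.1 (hF.1 heF'))).ne'
  rw [exchangeTriple, Finset.prod_insert (by simp [heF]), ← Finset.mul_prod_erase F w heF']
  field_simp

theorem sum_edgeStretch_le (hw : ∀ e ∈ G.edgeSet, 0 < w e) {F : Finset (Sym2 V)}
    (hF : IsSpanningTree G F) : ∑ e ∈ F, edgeStretch w F e ≤ (Fintype.card V : ℝ) - 1 := by
  have hc : (F.card : ℝ) + 1 = Fintype.card V := by exact_mod_cast hF.card_add_one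
  rw [← hc, add_sub_cancel_right]
  have h : ∑ e ∈ F, edgeStretch w F e ≤ ∑ e ∈ F, (1 : ℝ) := by
    refine Finset.sum_le_sum fun e he => ?_
    have hpos := hw e (SimpleGraph.mem_edgeFinset.1 (hF.1 he))
    refine (Finset.sum_le_sum_of_subset_of_nonneg (treePathEdges_subset_singleton hF.2 he
      (not_isDiag_of_mem_edgeFinset (hF.1 he))) fun f hf _ => ?_).trans ?_
    · rw [Finset.mem_singleton.1 hf]
      positivity
    · simp [hpos.ne']
  simpa using h

/-- The total weighted stretch is bounded in terms of the total weight of the triples that arise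
by exchanges. -/
theorem expectedStretch_mul_le (hG : G.Connected) (hw : ∀ e ∈ G.edgeSet, 0 < w e) :
    expectedStretch G w * ∑ F ∈ spanningTrees G, ∏ f ∈ F, w f ≤
      (∑ F ∈ spanningTrees G, ∏ f ∈ F, w f) * ((Fintype.card V : ℝ) - 1) +
        ∑ x ∈ (pathTriples G).image exchangeTriple, ∏ f ∈ x.1, w f := by
  have hZ : 0 < ∑ F ∈ spanningTrees G, ∏ f ∈ F, w f :=
    Finset.sum_pos (fun F hF => prod_pos_of_isSpanningTree hw (mem_spanningTrees.1 hF))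
      (spanningTrees_nonempty hG)
  rw [← sum_exchangeTriple hw, expectedStretch, Finset.sum_mul, Finset.sum_mul,
    ← Finset.sum_add_distrib]
  refine Finset.sum_le_sum fun F hF => ?_
  rw [mem_spanningTrees] at hF
  rw [treeProb, mul_right_comm, div_mul_cancel₀ _ hZ.ne', ← mul_add, graphStretch,
    ← Finset.sum_sdiff hF.1, add_comm]
  exact mul_le_mul_of_nonneg_left (by gcongr; exact sum_edgeStretch_le hw hF)
    (prod_pos_of_isSpanningTree hw hF).le

/-- If some set of `n - 1` edges is not a spanning tree, then not every cross triple arises by an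
exchange. -/
theorem exists_crossTriple_notMem_image (hG : G.Connected) {H : Finset (Sym2 V)}
    (hH : H ⊆ G.edgeFinset) (hc : H.card + 1 = Fintype.card V) (hHT : ¬ IsSpanningTree G H) :
    ∃ x ∈ crossTriples G, x ∉ (pathTriples G).image exchangeTriple := by
  by_contra! hall
  obtain ⟨T, hT⟩ := spanningTrees_nonempty hG
  rw [mem_spanningTrees] at hT
  refine hHT (Finset.mem_of_forall_exchange (P := IsSpanningTree G) ?_ hH T hT
    (by have := hT.card_add_one; omega))
  intro S hS e he e' he'
  rw [Finset.mem_sdiff] at he'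
  -- A preimage of `(S, e, e')` contains a spanning tree `F` with `S = F - e' + e`, so `S - e + e'`
  -- is `F` itself.
  obtain ⟨⟨F, f, f'⟩, hx, heq⟩ := Finset.mem_image.1 (hall (S, e, e') (by
    simp only [crossTriples, Finset.mem_filter, Finset.mem_product, mem_spanningTrees]
    exact ⟨⟨hS, hS.1 he, he'.1⟩, he, he'.2⟩))
  simp only [exchangeTriple, Prod.mk.injEq] at heq
  obtain ⟨rfl, rfl, rfl⟩ := heq
  simp only [pathTriples, Finset.mem_filter, Finset.mem_product, mem_spanningTrees] at hx
  rw [insert_erase_exchange hx.2.1 (mem_of_mem_treePathEdges hx.2.2)]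
  exact hx.1.1

end

theorem mainTheorem10 {V : Type*} [Fintype V] [DecidableEq V] (G : SimpleGraph V)
    [DecidableRel G.Adj] (hG : G.Connected) (w : Sym2 V → ℝ) (hw : ∀ e ∈ G.edgeSet, 0 < w e) :
    expectedStretch G w ≤
        ((Fintype.card V : ℝ) - 1) * ((G.edgeFinset.card : ℝ) - (Fintype.card V : ℝ) + 2) ∧
      ((∃ H : Finset (Sym2 V), H ⊆ G.edgeFinset ∧ H.card + 1 = Fintype.card V ∧
          ¬ IsSpanningTree G H) →
        expectedStretch G w <
          ((Fintype.card V : ℝ) - 1) * ((G.edgeFinset.card : ℝ) - (Fintype.card V : ℝ) + 2)) := by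
  have hZ : 0 < ∑ F ∈ spanningTrees G, ∏ f ∈ F, w f :=
    Finset.sum_pos (fun F hF => prod_pos_of_isSpanningTree hw (mem_spanningTrees.1 hF))
      (spanningTrees_nonempty hG)
  have hpos : ∀ x ∈ crossTriples G, 0 < ∏ f ∈ x.1, w f := fun x hx =>
    prod_pos_of_isSpanningTree hw
      (mem_spanningTrees.1 (Finset.mem_product.1 (Finset.mem_filter.1 hx).1).1)
  have hbound := expectedStretch_mul_le hG hw
  have hcross := sum_crossTriples (G := G) (w := w)
  constructor
  · have hle := Finset.sum_le_sum_of_subset_of_nonneg (f := fun x => ∏ f ∈ x.1, w f)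
      (image_exchangeTriple_subset (G := G)) fun x hx _ => (hpos x hx).le
    -- The summand `n - 1` from the tree edges raises `m - n + 1` to `m - n + 2`.
    refine le_of_mul_le_mul_right ?_ hZ
    linarith
  · rintro ⟨H, hH, hc, hHT⟩
    obtain ⟨x, hx, hx'⟩ := exists_crossTriple_notMem_image hG hH hc hHT
    have hlt := Finset.sum_lt_sum_of_subset (f := fun x => ∏ f ∈ x.1, w f)
      (image_exchangeTriple_subset (G := G)) hx hx' (hpos x hx) fun y hy _ => (hpos y hy).le
    refine lt_of_mul_lt_mul_right ?_ hZ.le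
    linarith
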